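/- Let $\mathbb X\subseteq\mathbb R^d$ be a Borel set (for instance $\mathbb X=\mathbb R^d$) and let $\mathbb A\subset\mathbb R^m$ be compact. On a probability space $(\Omega,\mathcal F,P)$ let $X$ be an $\mathbb X$-valued and $U$ an $\mathbb A$-valued random variable such that $U$ is generated by a randomized stationary policy, i.e. there is a stochastic kernel $\varphi(du\mid x)$ from $\mathbb X$ to $\mathbb A$ such that $(X,U)$ has law $\mu(dx)\,\varphi(du\mid x)$, where $\mu$ is the law of $X$. Suppose that $\mu$ is non-atomic, i.e. $P(X=x)=0$ for every $x\in\mathbb X$. The $w$-$s$ topology on the set $\mathcal P(\mathbb X\times\mathbb A)$ of Borel probability measures is the coarsest topology for which $\nu\mapsto\int f\,d\nu$ is continuous for every bounded measurable $f:\mathbb X\times\mathbb A\to\mathbb R$ such that $u\mapsto f(x,u)$ is continuous for every $x\in\mathbb X$. Random variables are said to converge weakly (respectively in the $w$-$s$ sense) if their laws converge in the weak (respectively $w$-$s$) topology. **Theorem.** There exist measurable maps $\gamma_n:\mathbb X\to\mathbb A$, $n\in\mathbb N$, such that: 1. $(X,\gamma_n(X))$ converges weakly to $(X,U)$ as $n\to\infty$.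 2. $(X,\gamma_n(X))$ converges to $(X,U)$ in the $w$-$s$ sense. 3. For every sequence $(X_n)$ of $\mathbb X$-valued random variables (possibly defined on different probability spaces) whose laws $\mu_n$ converge to $\mu$ in total variation, i.e. $\sup_{B}|\mu_n(B)-\mu(B)|\to0$ with the supremum over Borel sets $B\subseteq\mathbb X$, the pair $(X_n,\gamma_n(X_n))$ converges to $(X,U)$ both weakly and in the $w$-$s$ sense. The same maps $\gamma_n$ serve for all such sequences. -/

import Mathlib

open MeasureTheory ProbabilityTheory Filter
open scoped Topology

noncomputable section

/-- The `w`-`s` (weak-setwise) topology on the probability measures on `𝕏 × 𝔸`: the coarsest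
topology for which `ν ↦ ∫ f dν` is continuous for every bounded measurable `f : 𝕏 × 𝔸 → ℝ` such
that `f (x, ·)` is continuous for every `x`. -/
abbrev wsTopology (𝕏 𝔸 : Type*) [MeasurableSpace 𝕏] [MeasurableSpace 𝔸] [TopologicalSpace 𝔸] :
    TopologicalSpace (ProbabilityMeasure (𝕏 × 𝔸)) :=
  ⨅ f : {f : 𝕏 × 𝔸 → ℝ // Measurable f ∧ (∃ C : ℝ, ∀ z, |f z| ≤ C) ∧
      ∀ x, Continuous fun u => f (x, u)},
    TopologicalSpace.induced
      (fun ν : ProbabilityMeasure (𝕏 × 𝔸) => ∫ z, f.1 z ∂(ν : Measure (𝕏 × 𝔸))) inferInstance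

/-- `Z i` converges to `Z'` in the `w`-`s` sense along `l`: the laws converge in the `w`-`s`
topology. The random variables may live on different probability spaces. This is the analogue of
`MeasureTheory.TendstoInDistribution` for the `w`-`s` topology. -/
structure TendstoWS {ι 𝕏 𝔸 Ω' : Type*} {Ω : ι → Type*} [MeasurableSpace 𝕏] [MeasurableSpace 𝔸]
    [TopologicalSpace 𝔸] [∀ i, MeasurableSpace (Ω i)] [MeasurableSpace Ω']
    (Z : (i : ι) → Ω i → 𝕏 × 𝔸) (l : Filter ι) (Z' : Ω' → 𝕏 × 𝔸)
    (P : (i : ι) → Measure (Ω i)) [∀ i, IsProbabilityMeasure (P i)]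
    (P' : Measure Ω') [IsProbabilityMeasure P'] : Prop where
  forall_aemeasurable : ∀ i, AEMeasurable (Z i) (P i)
  aemeasurable_limit : AEMeasurable Z' P'
  tendsto : Tendsto (β := ProbabilityMeasure (𝕏 × 𝔸))
      (fun i => ⟨(P i).map (Z i), Measure.isProbabilityMeasure_map (forall_aemeasurable i)⟩) l
      (@nhds _ (wsTopology 𝕏 𝔸)
        ⟨P'.map Z', Measure.isProbabilityMeasure_map aemeasurable_limit⟩)

/-- The total variation distance `sup_B |μ(B) - ν(B)|` over measurable sets `B`
(used for probability measures, where the supremum is over a set bounded by `1`). -/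
def tvDist {S : Type*} [MeasurableSpace S] (μ ν : Measure S) : ℝ :=
  ⨆ B : {B : Set S // MeasurableSet B}, |μ.real B.1 - ν.real B.1|

end

/-! A non-atomic measure can be mapped onto any measure of equal mass
(`exists_measurable_map_eq_of_nullSingletonClass`). So on each cell of the `n`-th partition of `𝕏`,
a measurable map can give the action exactly the law that `φ` gives it over that cell; gluing over
the cells gives `γ n`. For a function of the action alone, integrals under `γ n` and under `φ` then
agree over every set of the `m`-th partition algebra once `n ≥ m`.

Uniform boundedness carries this, in the limit, to all measurable sets. Density of simple functions
in `L¹(μ; C(𝔸))` carries it to bounded Carathéodory functions, which is `w`-`s` convergence.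
Replacing `μ` by another state law costs at most `2 * C` times the total variation distance,
whatever `γ n` is, so the same maps serve all sequences. Weak convergence follows because bounded
continuous functions are Carathéodory. -/

/-! ### Transport of non-atomic measures -/

/-- The jump of the cdf at a point is the mass of that point. -/
lemma continuous_cdf (ν : Measure ℝ) [IsProbabilityMeasure ν] [NullSingletonClass ν] :
    Continuous (cdf ν) := by
  rw [continuous_iff_continuousAt]
  intro a
  rw [(monotone_cdf ν).continuousAt_iff_leftLim_eq_rightLim, StieltjesFunction.rightLim_eq]
  refine le_antisymm ((monotone_cdf ν).leftLim_le le_rfl) ?_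
  have h := StieltjesFunction.measure_singleton (cdf ν) a
  rw [measure_cdf, measure_singleton, eq_comm, ENNReal.ofReal_eq_zero] at h
  linarith

/-- The probability integral transform: a continuous cdf pushes its own law to the uniform one. -/
lemma measure_cdf_le (ν : Measure ℝ) [IsProbabilityMeasure ν] [NullSingletonClass ν]
    {t : ℝ} (h0 : 0 ≤ t) (h1 : t ≤ 1) :
    ν {x | cdf ν x ≤ t} = ENNReal.ofReal t := by
  -- At `t = 1` the sublevel set is the whole line and has no supremum.
  rcases h1.eq_or_lt with rfl | h1
  · simp [cdf_le_one]
  set S := {x | cdf ν x ≤ t} with hS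
  have hbdd : BddAbove S := by
    obtain ⟨b, hb⟩ := ((tendsto_cdf_atTop ν).eventually (lt_mem_nhds h1)).exists
    exact ⟨b, fun x hx => le_of_not_gt fun hbx => absurd hb
      (not_lt.2 ((monotone_cdf ν hbx.le).trans hx))⟩
  rcases S.eq_empty_or_nonempty with hem | hne
  · have : t = 0 := by
      refine le_antisymm (le_of_not_gt fun ht => ?_) h0
      obtain ⟨b, hb⟩ := ((tendsto_cdf_atBot ν).eventually (gt_mem_nhds ht)).exists
      exact (Set.eq_empty_iff_forall_notMem.1 hem b) hb.le
    simp [hem, this]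
  have hcl : IsClosed S := isClosed_le (continuous_cdf ν) continuous_const
  have hmem : cdf ν (sSup S) ≤ t := hcl.csSup_mem hne hbdd
  have hIic : S = Set.Iic (sSup S) :=
    Set.Subset.antisymm (fun x hx => le_csSup hbdd hx)
      fun x hx => (monotone_cdf ν hx).trans hmem
  -- If the cdf were below `t` at the supremum, continuity would keep it below `t` slightly to the
  -- right.
  have heq : cdf ν (sSup S) = t := by
    refine le_antisymm hmem (le_of_not_gt fun hlt => ?_)
    have hev : ∀ᶠ x in 𝓝[>] (sSup S), cdf ν x < t :=
      (((continuous_cdf ν).tendsto _).eventually (gt_mem_nhds hlt)).filter_mono nhdsWithin_le_nhds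
    obtain ⟨x, hx, hx'⟩ := (hev.and self_mem_nhdsWithin).exists
    exact absurd (le_csSup hbdd hx.le) (not_le.2 hx')
  rw [hIic, ← ofReal_cdf, heq]

lemma exists_measurable_map_eq_volume_unitInterval {𝕏 : Type*} [MeasurableSpace 𝕏]
    [StandardBorelSpace 𝕏] (μ : Measure 𝕏) [IsProbabilityMeasure μ] [NullSingletonClass μ] :
    ∃ T : 𝕏 → unitInterval, Measurable T ∧ μ.map T = volume := by
  have he := measurableEmbedding_embeddingReal 𝕏
  set ν : Measure ℝ := μ.map (embeddingReal 𝕏) with hν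
  have : IsProbabilityMeasure ν := Measure.isProbabilityMeasure_map he.measurable.aemeasurable
  have : NullSingletonClass ν := ⟨fun x => by
    rw [hν, he.map_apply]
    exact (Set.subsingleton_singleton.preimage he.injective).measure_zero _⟩
  let T : ℝ → unitInterval := fun x => ⟨cdf ν x, cdf_nonneg ν x, cdf_le_one ν x⟩
  have hT : Measurable T := ((continuous_cdf ν).measurable).subtype_mk
  refine ⟨T ∘ embeddingReal 𝕏, hT.comp he.measurable, ?_⟩
  rw [← Measure.map_map hT he.measurable]
  have : IsProbabilityMeasure (ν.map T) := Measure.isProbabilityMeasure_map hT.aemeasurable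
  refine Measure.ext_of_Iic _ _ fun t => ?_
  rw [Measure.map_apply hT measurableSet_Iic, unitInterval.volume_Iic,
    ← measure_cdf_le ν t.2.1 t.2.2]
  rfl

/-- After normalisation, `μ` is pushed to the uniform law on the unit interval, which maps onto
every law on a standard Borel space. Zero mass cannot be normalised and is treated apart. -/
lemma exists_measurable_map_eq_of_nullSingletonClass {𝕏 𝔸 : Type*} [MeasurableSpace 𝕏]
    [StandardBorelSpace 𝕏] [MeasurableSpace 𝔸] [StandardBorelSpace 𝔸] [Nonempty 𝔸]
    (μ : Measure 𝕏) [IsFiniteMeasure μ] [NullSingletonClass μ] (ν : Measure 𝔸)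
    (h : ν Set.univ = μ Set.univ) :
    ∃ γ : 𝕏 → 𝔸, Measurable γ ∧ μ.map γ = ν := by
  by_cases h0 : μ Set.univ = 0
  · rw [h0] at h
    rw [Measure.measure_univ_eq_zero] at h h0
    exact ⟨fun _ => Classical.arbitrary 𝔸, measurable_const, by simp [h, h0]⟩
  set c := μ Set.univ with hc
  have hct : c ≠ ⊤ := measure_ne_top _ _
  have : IsProbabilityMeasure (c⁻¹ • μ) := ⟨by simp [← hc, ENNReal.inv_mul_cancel h0 hct]⟩
  have : IsProbabilityMeasure (c⁻¹ • ν) := ⟨by simp [h, ENNReal.inv_mul_cancel h0 hct]⟩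
  have : NullSingletonClass (c⁻¹ • μ) := ⟨fun x => by simp⟩
  obtain ⟨T, hT, hTm⟩ := exists_measurable_map_eq_volume_unitInterval (c⁻¹ • μ)
  obtain ⟨f, hf, hfm⟩ := Measure.exists_measurable_map_eq (c⁻¹ • ν)
  refine ⟨f ∘ T, hf.comp hT, ?_⟩
  have key : c⁻¹ • μ.map (f ∘ T) = c⁻¹ • ν := by
    rw [← Measure.map_smul, ← Measure.map_map hf hT, hTm, hfm]
  have := congrArg (fun m => c • m) key
  simpa [smul_smul, ENNReal.mul_inv_cancel h0 hct] using this

/-! ### Policies matching the kernel on partition cells -/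

open MeasurableSpace in
/-- A policy that reproduces the joint law of the kernel exactly on each cell of the `n`-th
countable partition. -/
lemma exists_measurable_map_restrict_eq_bind {𝕏 𝔸 : Type*} [MeasurableSpace 𝕏]
    [StandardBorelSpace 𝕏] [MeasurableSpace 𝔸] [StandardBorelSpace 𝔸] [Nonempty 𝔸]
    (μ : Measure 𝕏) [IsFiniteMeasure μ] [NullSingletonClass μ] (φ : Kernel 𝕏 𝔸)
    [IsMarkovKernel φ] (n : ℕ) :
    ∃ γ : 𝕏 → 𝔸, Measurable γ ∧ ∀ I ∈ countablePartition 𝕏 n,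
      (μ.restrict I).map γ = (μ.restrict I).bind φ := by
  have H (I : countablePartition 𝕏 n) : ∃ g : 𝕏 → 𝔸, Measurable g ∧
      (μ.restrict I).map g = (μ.restrict I).bind φ := by
    refine exists_measurable_map_eq_of_nullSingletonClass _ _ ?_
    rw [Measure.bind_apply .univ φ.measurable.aemeasurable]
    simp
  choose g hg hgm using H
  let i : 𝕏 → countablePartition 𝕏 n := fun x =>
    ⟨countablePartitionSet n x, countablePartitionSet_mem n x⟩
  -- There are countably many cells, so with the discrete σ-algebra on them gluing preserves
  -- measurability.
  let _ : MeasurableSpace (countablePartition 𝕏 n) := ⊤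
  have hi : Measurable i :=
    (measurable_countablePartitionSet_subtype n ⊤).mono ((countableFiltration 𝕏).le n) le_rfl
  have hG : Measurable fun p : countablePartition 𝕏 n × 𝕏 => g p.1 p.2 :=
    measurable_from_prod_countable_right fun I => hg I
  refine ⟨fun x => g (i x) x, hG.comp (hi.prodMk measurable_id), fun I hI => ?_⟩
  rw [← hgm ⟨I, hI⟩]
  refine Measure.map_congr ?_
  filter_upwards [ae_restrict_mem (measurableSet_countablePartition n hI)] with x hx
  have : i x = ⟨I, hI⟩ := Subtype.ext (countablePartitionSet_of_mem hI hx)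
  rw [this]

-- Each set of the `n`-th algebra is a finite disjoint union of cells, and both sides are additive.
open MeasurableSpace in
lemma map_restrict_eq_bind_of_measurableSet {𝕏 𝔸 : Type*} [MeasurableSpace 𝕏]
    [CountablyGenerated 𝕏] [MeasurableSpace 𝔸] {μ : Measure 𝕏} {φ : Kernel 𝕏 𝔸} {n : ℕ}
    {γ : 𝕏 → 𝔸} (hγ : Measurable γ)
    (h : ∀ I ∈ countablePartition 𝕏 n, (μ.restrict I).map γ = (μ.restrict I).bind φ)
    {B : Set 𝕏} (hB : MeasurableSet[countableFiltration 𝕏 n] B) :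
    (μ.restrict B).map γ = (μ.restrict B).bind φ := by
  obtain ⟨S, hS, rfl⟩ := (measurableSet_generateFrom_countablePartition_iff n B).1 hB
  clear hB
  induction S using Finset.induction_on with
  | empty => simp
  | insert I S hI ih =>
    simp only [Finset.coe_insert, Set.insert_subset_iff] at hS
    have hm : MeasurableSet (⋃₀ (S : Set (Set 𝕏))) :=
      .sUnion S.countable_toSet fun J hJ => measurableSet_countablePartition n (hS.2 hJ)
    have hd : Disjoint I (⋃₀ (S : Set (Set 𝕏))) := Set.disjoint_sUnion_right.2 fun J hJ =>
      disjoint_countablePartition hS.1 (hS.2 hJ) fun e => hI (e ▸ hJ)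
    rw [Finset.coe_insert, Set.sUnion_insert, Measure.restrict_union hd hm,
      Measure.map_add _ _ hγ, Measure.comp_add, h I hS.1, ih hS.2]

/-! ### From the filtration to all measurable sets -/

/-- If `k n` is uniformly bounded and the set integrals of `k n` are eventually equal to those of
`g` on each set of the countable filtration, then they converge on every measurable set. -/
lemma tendsto_setIntegral_of_eventually_eq_countableFiltration {𝕏 : Type*} [MeasurableSpace 𝕏]
    [MeasurableSpace.CountablyGenerated 𝕏] {μ : Measure 𝕏} [IsFiniteMeasure μ]
    {k : ℕ → 𝕏 → ℝ} {g : 𝕏 → ℝ} {C : ℝ} (hk : ∀ n, Integrable (k n) μ) (hg : Integrable g μ)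
    (hkC : ∀ n x, ‖k n x‖ ≤ C)
    (h : ∀ m (B : Set 𝕏), MeasurableSet[countableFiltration 𝕏 m] B →
      ∀ n ≥ m, ∫ x in B, k n x ∂μ = ∫ x in B, g x ∂μ)
    {B : Set 𝕏} (hB : MeasurableSet B) :
    Tendsto (fun n => ∫ x in B, k n x ∂μ) atTop (𝓝 (∫ x in B, g x ∂μ)) := by
  have hgen := (iSup_countableFiltration 𝕏).symm.trans
    (MeasurableSpace.measurableSpace_iSup_eq (countableFiltration 𝕏))
  have hpi := isPiSystem_iUnion_of_monotone _
    (fun n => @MeasurableSpace.isPiSystem_measurableSet _ (countableFiltration 𝕏 n))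
    fun _ _ => (countableFiltration 𝕏).mono
  replace hgen : ‹MeasurableSpace 𝕏› = MeasurableSpace.generateFrom
      (⋃ n, {s : Set 𝕏 | MeasurableSet[countableFiltration 𝕏 n] s}) := by
    refine hgen.trans ?_
    congr 1
    ext s
    simp
  induction B, hB using MeasurableSpace.induction_on_inter hgen hpi with
  | empty => simp
  | basic B hB =>
    obtain ⟨m, hm⟩ := Set.mem_iUnion.1 hB
    exact tendsto_const_nhds.congr' (by
      filter_upwards [eventually_ge_atTop m] with n hn using (h m B hm n hn).symm)
  | compl B hB ih =>
    have hu : Tendsto (fun n => ∫ x, k n x ∂μ) atTop (𝓝 (∫ x, g x ∂μ)) :=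
      tendsto_const_nhds.congr fun n => by
        simpa using (h 0 Set.univ (@MeasurableSet.univ _ (countableFiltration 𝕏 0)) n
          (Nat.zero_le n)).symm
    rw [setIntegral_compl hB hg]
    simpa only [setIntegral_compl hB (hk _)] using hu.sub ih
  | iUnion f hd hf ih =>
    have hs : ∀ n, ∫ x in ⋃ i, f i, k n x ∂μ = ∑' i, ∫ x in f i, k n x ∂μ :=
      fun n => integral_iUnion hf hd (hk n).integrableOn
    simp_rw [hs, integral_iUnion hf hd hg.integrableOn]
    -- The uniform bound gives the majorant `C * μ.real (f i)`, summable because the `f i` are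
    -- disjoint and `μ` is finite.
    refine tendsto_tsum_of_dominated_convergence (bound := fun i => C * μ.real (f i)) ?_ ih ?_
    · refine Summable.mul_left _ ?_
      have := measure_iUnion (μ := μ) hd hf
      exact ENNReal.summable_toReal (this ▸ measure_ne_top _ _)
    · exact .of_forall fun n i =>
        norm_setIntegral_le_of_norm_le_const (measure_lt_top _ _) fun x _ => hkC n x

/-! ### Measurability in `C(𝔸, ℝ)` and the total variation estimate -/

/-- A closed sup-norm ball is cut out by conditions at countably many dense points, and every open
set is a countable union of such balls. -/
lemma measurable_continuousMap_of_eval {𝕏 𝔸 : Type*} [MeasurableSpace 𝕏] [TopologicalSpace 𝔸]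
    [CompactSpace 𝔸] [TopologicalSpace.SeparableSpace 𝔸] [Nonempty 𝔸]
    [SecondCountableTopology C(𝔸, ℝ)] [MeasurableSpace C(𝔸, ℝ)] [BorelSpace C(𝔸, ℝ)]
    {F : 𝕏 → C(𝔸, ℝ)} (hF : ∀ u, Measurable fun x => F x u) : Measurable F := by
  have hball : ∀ (c : C(𝔸, ℝ)) (r : ℝ), 0 ≤ r →
      MeasurableSet (F ⁻¹' Metric.closedBall c r) := by
    intro c r hr
    have : F ⁻¹' Metric.closedBall c r =
        ⋂ i, {x | dist (F x (TopologicalSpace.denseSeq 𝔸 i)) (c (TopologicalSpace.denseSeq 𝔸 i))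
          ≤ r} := by
      ext x
      simp only [Set.mem_preimage, Metric.mem_closedBall, ContinuousMap.dist_le hr, Set.mem_iInter,
        Set.mem_ofPred_eq]
      refine ⟨fun h i => h _, fun h u => ?_⟩
      have hcl : IsClosed {u | dist (F x u) (c u) ≤ r} :=
        isClosed_le ((F x).continuous.dist c.continuous) continuous_const
      exact (TopologicalSpace.denseRange_denseSeq 𝔸).induction_on u hcl h
    rw [this]
    exact .iInter fun i => measurableSet_le ((hF _).dist measurable_const) measurable_const
  refine measurable_of_isOpen fun O hO => ?_
  have hr : ∀ c : O, ∃ r > 0, Metric.closedBall (c : C(𝔸, ℝ)) r ⊆ O := fun c =>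
    Metric.nhds_basis_closedBall.mem_iff.1 (hO.mem_nhds c.2)
  choose r hr0 hrO using hr
  obtain ⟨T, hT, hTU⟩ := TopologicalSpace.isOpen_iUnion_countable
    (fun c : O => Metric.ball (c : C(𝔸, ℝ)) (r c)) fun c => Metric.isOpen_ball
  have hO' : O = ⋃ c ∈ T, Metric.closedBall (c : C(𝔸, ℝ)) (r c) := by
    refine Set.Subset.antisymm (fun c hc => ?_) (Set.iUnion₂_subset fun c _ => hrO c)
    have : c ∈ ⋃ c : O, Metric.ball (c : C(𝔸, ℝ)) (r c) :=
      Set.mem_iUnion.2 ⟨⟨c, hc⟩, Metric.mem_ball_self (hr0 _)⟩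
    rw [← hTU] at this
    exact Set.iUnion₂_mono (fun _ _ => Metric.ball_subset_closedBall) this
  rw [hO']
  simp only [Set.preimage_iUnion]
  exact .biUnion hT fun c _ => hball _ _ (hr0 c).le

/-- Layer cake: `k + C` takes values in `[0, 2 * C]`, and each of its superlevel sets contributes at
most `tvDist μ ν`. -/
lemma abs_integral_sub_integral_le_tvDist {S : Type*} [MeasurableSpace S] (μ ν : Measure S)
    [IsProbabilityMeasure μ] [IsProbabilityMeasure ν] {k : S → ℝ} (hk : Measurable k) {C : ℝ}
    (hC : 0 ≤ C) (hkC : ∀ x, |k x| ≤ C) :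
    |∫ x, k x ∂μ - ∫ x, k x ∂ν| ≤ 2 * C * tvDist μ ν := by
  have hint (ρ : Measure S) [IsProbabilityMeasure ρ] : Integrable k ρ :=
    .of_bound hk.aestronglyMeasurable C (.of_forall hkC)
  have hlay (ρ : Measure S) [IsProbabilityMeasure ρ] :
      ∫ x, k x ∂ρ = (∫ t in Set.Ioc 0 (2 * C), ρ.real {x | t ≤ k x + C}) - C := by
    rw [← Integrable.integral_eq_integral_Ioc_meas_le (f := fun x => k x + C)
      ((hint ρ).add (integrable_const C)), integral_add (hint ρ) (integrable_const C)]
    · simp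
    · exact .of_forall fun x => by have := (abs_le.1 (hkC x)).1; simp only [Pi.zero_apply]; linarith
    · exact .of_forall fun x => by have := (abs_le.1 (hkC x)).2; simp only; linarith
  have hbdd : BddAbove (Set.range fun B : {B : Set S // MeasurableSet B} =>
      |μ.real B.1 - ν.real B.1|) := by
    refine ⟨1, ?_⟩
    rintro _ ⟨B, rfl⟩
    exact abs_sub_le_of_nonneg_of_le measureReal_nonneg measureReal_le_one measureReal_nonneg
      measureReal_le_one
  have hanti (ρ : Measure S) [IsProbabilityMeasure ρ] :
      IntegrableOn (fun t => ρ.real {x | t ≤ k x + C}) (Set.Ioc 0 (2 * C)) := by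
    have : Antitone fun t => ρ.real {x | t ≤ k x + C} := fun s t hst =>
      measureReal_mono fun x hx => hst.trans hx
    exact ((this.antitoneOn _).integrableOn_isCompact isCompact_Icc).mono_set Set.Ioc_subset_Icc_self
  rw [hlay μ, hlay ν, sub_sub_sub_cancel_right, ← integral_sub (hanti μ) (hanti ν)]
  have hle : ∀ t ∈ Set.Ioc 0 (2 * C),
      ‖μ.real {x | t ≤ k x + C} - ν.real {x | t ≤ k x + C}‖ ≤ tvDist μ ν := fun t _ =>
    le_ciSup hbdd ⟨{x | t ≤ k x + C}, measurableSet_le measurable_const (hk.add_const C)⟩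
  refine (norm_setIntegral_le_of_norm_le_const measure_Ioc_lt_top hle).trans ?_
  rw [Real.volume_real_Ioc_of_le (by linarith), sub_zero, mul_comm]
-- Carathéodory functions as maps into `C(𝔸, ℝ)`
section Caratheodory

variable {𝕏 𝔸 : Type*} [MeasurableSpace 𝕏] [MeasurableSpace 𝔸] [TopologicalSpace 𝔸]
  [CompactSpace 𝔸] [TopologicalSpace.PseudoMetrizableSpace 𝔸] [SecondCountableTopology 𝔸]
  [BorelSpace 𝔸]

lemma integrable_eval_of_map_fst {μ : Measure 𝕏} {ρ : Measure (𝕏 × 𝔸)}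
    (hρ : ρ.map Prod.fst = μ) {F : 𝕏 → C(𝔸, ℝ)} (hF : Integrable F μ) :
    Integrable (fun z : 𝕏 × 𝔸 => F z.1 z.2) ρ := by
  have hmp : MeasurePreserving Prod.fst ρ μ := ⟨measurable_fst, hρ⟩
  have hF' : Integrable (fun z : 𝕏 × 𝔸 => F z.1) ρ := hmp.integrable_comp_of_integrable hF
  have hev : Continuous fun p : C(𝔸, ℝ) × 𝔸 => p.1 p.2 := continuous_eval
  refine hF'.norm.mono' (hev.comp_aestronglyMeasurable
    (hF'.aestronglyMeasurable.prodMk measurable_snd.stronglyMeasurable.aestronglyMeasurable))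
    (.of_forall fun z => (F z.1).norm_coe_le_norm z.2)

/-- The bound depends on `ρ` only through its first marginal, hence is uniform along a sequence
sharing that marginal. -/
lemma abs_integral_eval_sub_le {μ : Measure 𝕏} {ρ : Measure (𝕏 × 𝔸)}
    (hρ : ρ.map Prod.fst = μ) {F G : 𝕏 → C(𝔸, ℝ)} (hF : Integrable F μ) (hG : Integrable G μ) :
    |∫ z, F z.1 z.2 ∂ρ - ∫ z, G z.1 z.2 ∂ρ| ≤ ∫ x, ‖F x - G x‖ ∂μ := by
  have hmp : MeasurePreserving Prod.fst ρ μ := ⟨measurable_fst, hρ⟩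
  have hFG : Integrable (fun x => ‖F x - G x‖) μ := (hF.sub hG).norm
  rw [← integral_sub (integrable_eval_of_map_fst hρ hF) (integrable_eval_of_map_fst hρ hG),
    ← hρ, integral_map measurable_fst.aemeasurable (hρ ▸ hFG.aestronglyMeasurable)]
  refine norm_integral_le_of_norm_le (hmp.integrable_comp_of_integrable hFG)
    (.of_forall fun z => (F z.1 - G z.1).norm_coe_le_norm z.2)

/-- For measures with a common first marginal, convergence of the integrals of `1_B ⊗ h`, for `B`
measurable and `h` continuous, implies convergence of the integrals of integrable maps with values
in the space of continuous functions. -/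
lemma tendsto_integral_eval_of_forall_indicator {μ : Measure 𝕏} {ρ : ℕ → Measure (𝕏 × 𝔸)}
    {ρ' : Measure (𝕏 × 𝔸)} (hρ : ∀ n, (ρ n).map Prod.fst = μ) (hρ' : ρ'.map Prod.fst = μ)
    (h : ∀ B, MeasurableSet B → ∀ c : C(𝔸, ℝ),
      Tendsto (fun n => ∫ z in B ×ˢ Set.univ, c z.2 ∂(ρ n)) atTop
        (𝓝 (∫ z in B ×ˢ Set.univ, c z.2 ∂ρ')))
    {F : 𝕏 → C(𝔸, ℝ)} (hF : Integrable F μ) :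
    Tendsto (fun n => ∫ z, F z.1 z.2 ∂(ρ n)) atTop (𝓝 (∫ z, F z.1 z.2 ∂ρ')) := by
  refine Integrable.induction (fun F : 𝕏 → C(𝔸, ℝ) =>
    Tendsto (fun n => ∫ z, F z.1 z.2 ∂(ρ n)) atTop (𝓝 (∫ z, F z.1 z.2 ∂ρ'))) ?_ ?_ ?_ ?_ hF
  · intro c s hs _
    have key (σ : Measure (𝕏 × 𝔸)) : ∫ z, (s.indicator (fun _ => c) z.1) z.2 ∂σ =
        ∫ z in s ×ˢ Set.univ, c z.2 ∂σ := by
      rw [← integral_indicator (hs.prod .univ)]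
      congr 1 with z
      by_cases hz : z.1 ∈ s <;> simp [hz, Set.indicator]
    simpa only [key] using h s hs c
  · intro f g _ hf hg ihf ihg
    have key (σ : Measure (𝕏 × 𝔸)) (hσ : σ.map Prod.fst = μ) :
        ∫ z, ((f + g) z.1) z.2 ∂σ = ∫ z, f z.1 z.2 ∂σ + ∫ z, g z.1 z.2 ∂σ := by
      rw [← integral_add (integrable_eval_of_map_fst hσ hf) (integrable_eval_of_map_fst hσ hg)]
      rfl
    simpa only [key _ (hρ _), key _ hρ'] using ihf.add ihg
  -- An `ε / 3` argument: the two approximation errors are bounded by the same `L¹` distance for all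
  -- `n`.
  · refine isClosed_of_closure_subset fun f hf => Metric.tendsto_atTop.2 fun ε hε => ?_
    obtain ⟨g, hg, hfg⟩ := Metric.mem_closure_iff.1 hf (ε / 3) (by positivity)
    obtain ⟨N, hN⟩ := Metric.tendsto_atTop.1 hg (ε / 3) (by positivity)
    refine ⟨N, fun n hn => ?_⟩
    rw [L1.dist_eq_integral_dist] at hfg
    simp_rw [dist_eq_norm] at hfg
    have h1 := abs_integral_eval_sub_le (hρ n) (L1.integrable_coeFn f) (L1.integrable_coeFn g)
    have h2 := abs_integral_eval_sub_le hρ' (L1.integrable_coeFn f) (L1.integrable_coeFn g)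
    have h3 := hN n hn
    rw [Real.dist_eq] at h3 ⊢
    rw [abs_lt] at h3 ⊢
    rw [abs_le] at h1 h2
    constructor <;> linarith [h1.1, h1.2, h2.1, h2.2, h3.1, h3.2]
  · intro f g hfg _ ih
    have key (σ : Measure (𝕏 × 𝔸)) (hσ : σ.map Prod.fst = μ) :
        ∫ z, g z.1 z.2 ∂σ = ∫ z, f z.1 z.2 ∂σ := by
      have hmp : MeasurePreserving Prod.fst σ μ := ⟨measurable_fst, hσ⟩
      refine integral_congr_ae ?_
      filter_upwards [hmp.quasiMeasurePreserving.ae hfg] with z hz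
      rw [hz]
    simpa only [key _ (hρ _), key _ hρ'] using ih

end Caratheodory

/-! ### Approximation of the kernel and the conclusion -/

open MeasurableSpace in
/-- A Markov kernel is the limit of deterministic policies: against every bounded Carathéodory
function, and along every sequence of state laws converging in total variation to `μ`. -/
lemma exists_tendsto_integral_compProd {𝕏 𝔸 : Type*} [MeasurableSpace 𝕏]
    [StandardBorelSpace 𝕏] [MeasurableSpace 𝔸] [TopologicalSpace 𝔸] [CompactSpace 𝔸]
    [PolishSpace 𝔸] [BorelSpace 𝔸] (μ : Measure 𝕏) [IsProbabilityMeasure μ]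
    [NullSingletonClass μ] (φ : Kernel 𝕏 𝔸) [IsMarkovKernel φ] :
    ∃ γ : ℕ → 𝕏 → 𝔸, (∀ n, Measurable (γ n)) ∧ ∀ f : 𝕏 × 𝔸 → ℝ, Measurable f →
      (∃ C : ℝ, ∀ z, |f z| ≤ C) → (∀ x, Continuous fun u => f (x, u)) →
      ∀ ν : ℕ → Measure 𝕏, (∀ n, IsProbabilityMeasure (ν n)) →
        Tendsto (fun n => tvDist (ν n) μ) atTop (𝓝 0) →
        Tendsto (fun n => ∫ x, f (x, γ n x) ∂(ν n)) atTop (𝓝 (∫ z, f z ∂(μ ⊗ₘ φ))) := by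
  obtain ⟨x₀⟩ : Nonempty 𝕏 := μ.nonempty_of_neZero
  have : Nonempty 𝔸 := (φ x₀).nonempty_of_neZero
  choose γ hγ hγm using exists_measurable_map_restrict_eq_bind μ φ
  refine ⟨γ, hγ, fun f hf ⟨C, hC⟩ hfc ν hν htv => ?_⟩
  have hC0 : 0 ≤ C := (abs_nonneg _).trans (hC (x₀, γ 0 x₀))
  have hpm (n : ℕ) : Measurable fun x => (x, γ n x) := measurable_id.prodMk (hγ n)
  -- convergence under the fixed marginal `μ`
  have hμ : Tendsto (fun n => ∫ x, f (x, γ n x) ∂μ) atTop (𝓝 (∫ z, f z ∂(μ ⊗ₘ φ))) := by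
    let F : 𝕏 → C(𝔸, ℝ) := fun x => ⟨fun u => f (x, u), hfc x⟩
    let _ : MeasurableSpace C(𝔸, ℝ) := borel _
    have _ : BorelSpace C(𝔸, ℝ) := ⟨rfl⟩
    have hF : Integrable F μ := by
      refine .of_bound (measurable_continuousMap_of_eval fun u =>
        hf.comp measurable_prodMk_right).stronglyMeasurable.aestronglyMeasurable C
        (.of_forall fun x => ?_)
      exact (ContinuousMap.norm_le _ hC0).2 fun u => hC (x, u)
    have := tendsto_integral_eval_of_forall_indicator (ρ := fun n => μ.map fun x => (x, γ n x))
      (ρ' := μ ⊗ₘ φ) (μ := μ) (fun n => by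
        rw [Measure.map_map measurable_fst (hpm n)]
        simp [Function.comp_def])
      (Measure.fst_compProd μ φ) ?_ hF
    · refine this.congr fun n => ?_
      exact integral_map (hpm n).aemeasurable hf.aestronglyMeasurable
    intro B hB c
    have hci (σ : Measure 𝔸) [IsFiniteMeasure σ] : Integrable c σ :=
      .of_bound c.continuous.aestronglyMeasurable ‖c‖ (.of_forall c.norm_coe_le_norm)
    have hcz (σ : Measure (𝕏 × 𝔸)) [IsFiniteMeasure σ] : Integrable (fun z => c z.2) σ :=
      .of_bound (c.continuous.measurable.comp measurable_snd).aestronglyMeasurable ‖c‖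
        (.of_forall fun z => c.norm_coe_le_norm z.2)
    have h1 (n : ℕ) : ∫ z in B ×ˢ Set.univ, c z.2 ∂(μ.map fun x => (x, γ n x)) =
        ∫ x in B, c (γ n x) ∂μ := by
      rw [setIntegral_map (hB.prod .univ) (hcz _).aestronglyMeasurable (hpm n).aemeasurable]
      congr 2
      ext x; simp
    rw [Measure.setIntegral_compProd hB .univ (hcz _).integrableOn]
    simp_rw [h1, setIntegral_univ]
    refine tendsto_setIntegral_of_eventually_eq_countableFiltration (C := ‖c‖)
      (fun n => .of_bound (c.continuous.measurable.comp (hγ n)).aestronglyMeasurable ‖c‖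
        (.of_forall fun x => c.norm_coe_le_norm _)) 
      (.of_bound c.continuous.stronglyMeasurable.integral_kernel.aestronglyMeasurable ‖c‖
        (.of_forall fun x => (norm_integral_le_of_norm_le_const
          (.of_forall c.norm_coe_le_norm)).trans (by simp)))
      (fun n x => c.norm_coe_le_norm _) (fun m D hD n hmn => ?_) hB
    -- The filtration increases, so a set of level `m` is also a union of cells of level `n`.
    have hm := map_restrict_eq_bind_of_measurableSet (hγ n) (hγm n)
      ((countableFiltration 𝕏).mono hmn _ hD)
    refine (integral_map (μ := μ.restrict D) (hγ n).aemeasurable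
      c.continuous.aestronglyMeasurable).symm.trans ?_
    rw [hm, Measure.comp_eq_comp_const_apply, Kernel.integral_comp (hci _), Kernel.const_apply]
  -- The test function `x ↦ f (x, γ n x)` varies with `n`, but its bound `C` does not.
  have hdiff : Tendsto (fun n => ∫ x, f (x, γ n x) ∂(ν n) - ∫ x, f (x, γ n x) ∂μ) atTop (𝓝 0) :=
    squeeze_zero_norm (fun n => abs_integral_sub_integral_le_tvDist (ν n) μ (hf.comp (hpm n)) hC0
      fun x => hC _) (by simpa using htv.const_mul (2 * C))
  simpa using hdiff.add hμ

lemma tendsto_nhds_wsTopology_iff {ι 𝕏 𝔸 : Type*} [MeasurableSpace 𝕏] [MeasurableSpace 𝔸]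
    [TopologicalSpace 𝔸] {l : Filter ι} {ν : ι → ProbabilityMeasure (𝕏 × 𝔸)}
    {ν' : ProbabilityMeasure (𝕏 × 𝔸)} :
    Tendsto ν l (@nhds _ (wsTopology 𝕏 𝔸) ν') ↔
      ∀ f : 𝕏 × 𝔸 → ℝ, Measurable f → (∃ C : ℝ, ∀ z, |f z| ≤ C) →
        (∀ x, Continuous fun u => f (x, u)) →
        Tendsto (fun i => ∫ z, f z ∂(ν i : Measure (𝕏 × 𝔸))) l
          (𝓝 (∫ z, f z ∂(ν' : Measure (𝕏 × 𝔸)))) := by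
  simp only [nhds_iInf, tendsto_iInf, nhds_induced, tendsto_comap_iff, Subtype.forall,
    Function.comp_def]
  exact ⟨fun h f h1 h2 h3 => h f ⟨h1, h2, h3⟩, fun h f hf => h f hf.1 hf.2.1 hf.2.2⟩

lemma TendstoWS.tendstoInDistribution {ι 𝕏 𝔸 Ω' : Type*} {Ω : ι → Type*} [MeasurableSpace 𝕏]
    [TopologicalSpace 𝕏] [MeasurableSpace 𝔸] [TopologicalSpace 𝔸] [OpensMeasurableSpace (𝕏 × 𝔸)]
    [∀ i, MeasurableSpace (Ω i)] [MeasurableSpace Ω'] {Z : (i : ι) → Ω i → 𝕏 × 𝔸} {l : Filter ι}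
    {Z' : Ω' → 𝕏 × 𝔸} {P : (i : ι) → Measure (Ω i)} [∀ i, IsProbabilityMeasure (P i)]
    {P' : Measure Ω'} [IsProbabilityMeasure P'] (h : TendstoWS Z l Z' P P') :
    TendstoInDistribution Z l Z' P P' where
  forall_aemeasurable := h.forall_aemeasurable
  aemeasurable_limit := h.aemeasurable_limit
  tendsto := ProbabilityMeasure.tendsto_iff_forall_integral_tendsto.2
    fun f => tendsto_nhds_wsTopology_iff.1 h.tendsto f f.continuous.measurable
      ⟨‖f‖, f.norm_coe_le_norm⟩ fun x => f.continuous.comp (Continuous.prodMk_right x)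

lemma tendstoWS_prodMk_of_tendsto_integral {ι 𝕏 𝔸 Ω : Type*} {Ω' : ι → Type*}
    [MeasurableSpace 𝕏] [MeasurableSpace 𝔸] [TopologicalSpace 𝔸] [MeasurableSpace Ω]
    [∀ i, MeasurableSpace (Ω' i)] {l : Filter ι} {P : Measure Ω} [IsProbabilityMeasure P]
    {P' : (i : ι) → Measure (Ω' i)} [∀ i, IsProbabilityMeasure (P' i)]
    {X' : (i : ι) → Ω' i → 𝕏} (hX' : ∀ i, Measurable (X' i)) {γ : ι → 𝕏 → 𝔸}
    (hγ : ∀ i, Measurable (γ i)) {Z : Ω → 𝕏 × 𝔸} (hZ : Measurable Z)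
    (h : ∀ f : 𝕏 × 𝔸 → ℝ, Measurable f → (∃ C : ℝ, ∀ z, |f z| ≤ C) →
      (∀ x, Continuous fun u => f (x, u)) →
      Tendsto (fun i => ∫ x, f (x, γ i x) ∂((P' i).map (X' i))) l (𝓝 (∫ z, f z ∂(P.map Z)))) :
    TendstoWS (fun i ω => (X' i ω, γ i (X' i ω))) l Z P' P where
  forall_aemeasurable i := ((hX' i).prodMk ((hγ i).comp (hX' i))).aemeasurable
  aemeasurable_limit := hZ.aemeasurable
  tendsto := tendsto_nhds_wsTopology_iff.2 fun f hf hfb hfc => by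
    refine (h f hf hfb hfc).congr fun i => ?_
    exact (integral_map (hX' i).aemeasurable
      (hf.comp (measurable_id.prodMk (hγ i))).aestronglyMeasurable).trans
      (integral_map ((hX' i).prodMk ((hγ i).comp (hX' i))).aemeasurable
      hf.aestronglyMeasurable).symm

lemma tvDist_self {S : Type*} [MeasurableSpace S] (μ : Measure S) : tvDist μ μ = 0 := by
  simp [tvDist]
theorem theorem4p1 {d m : ℕ}
    -- the state space, a Borel subset of `ℝ^d`, and the action space, a compact subset of `ℝ^m`
    (𝕏 : Set (EuclideanSpace ℝ (Fin d))) (h𝕏 : MeasurableSet 𝕏)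
    (𝔸 : Set (EuclideanSpace ℝ (Fin m))) (h𝔸 : IsCompact 𝔸)
    {Ω : Type*} [MeasurableSpace Ω] (P : Measure Ω) [IsProbabilityMeasure P]
    (X : Ω → 𝕏) (hX : Measurable X) (U : Ω → 𝔸) (hU : Measurable U)
    -- `U` is generated from `X` by the randomized stationary policy `φ`
    (φ : Kernel 𝕏 𝔸) [IsMarkovKernel φ] (hφ : HasCondDistrib U X φ P)
    -- the law of `X` is non-atomic: it gives measure zero to every point
    (hna : NullSingletonClass (P.map X)) :
    ∃ γ : ℕ → 𝕏 → 𝔸, (∀ n, Measurable (γ n)) ∧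
      TendstoInDistribution (fun n ω => (X ω, γ n (X ω))) atTop (fun ω => (X ω, U ω))
        (fun _ => P) P ∧
      TendstoWS (fun n ω => (X ω, γ n (X ω))) atTop (fun ω => (X ω, U ω)) (fun _ => P) P ∧
      ∀ (Ω' : ℕ → Type*) [∀ n, MeasurableSpace (Ω' n)] (P' : (n : ℕ) → Measure (Ω' n))
        [∀ n, IsProbabilityMeasure (P' n)] (X' : (n : ℕ) → Ω' n → 𝕏),
        (∀ n, Measurable (X' n)) →
        Tendsto (fun n => tvDist ((P' n).map (X' n)) (P.map X)) atTop (𝓝 0) →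
        TendstoInDistribution (fun n ω => (X' n ω, γ n (X' n ω))) atTop (fun ω => (X ω, U ω))
          P' P ∧
        TendstoWS (fun n ω => (X' n ω, γ n (X' n ω))) atTop (fun ω => (X ω, U ω)) P' P := by
  have : StandardBorelSpace 𝕏 := h𝕏.standardBorel
  have : CompactSpace 𝔸 := isCompact_iff_compactSpace.1 h𝔸
  have : PolishSpace 𝔸 := h𝔸.isClosed.polishSpace
  have : IsProbabilityMeasure (P.map X) := Measure.isProbabilityMeasure_map hX.aemeasurable
  obtain ⟨γ, hγ, hlim⟩ := exists_tendsto_integral_compProd (P.map X) φ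
  -- The law of `(X, U)` is the composition product of the law of `X` with `φ`.
  rw [← hφ.map_eq] at hlim
  have hXU := hX.prodMk hU
  have hws : TendstoWS (fun n ω => (X ω, γ n (X ω))) atTop (fun ω => (X ω, U ω)) (fun _ => P) P :=
    tendstoWS_prodMk_of_tendsto_integral (X' := fun _ => X) (fun _ => hX) hγ hXU
      fun f hf hfb hfc => hlim f hf hfb hfc _ (fun _ => inferInstance) (by simp [tvDist_self])
  refine ⟨γ, hγ, hws.tendstoInDistribution, hws, fun Ω' _ P' _ X' hX' htv => ?_⟩
  have hws' := tendstoWS_prodMk_of_tendsto_integral (P := P) (P' := P') hX' hγ hXU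
    fun f hf hfb hfc => hlim f hf hfb hfc _
      (fun n => Measure.isProbabilityMeasure_map (hX' n).aemeasurable) htv
  exact ⟨hws'.tendstoInDistribution, hws'⟩
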